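/- Let $A$ be a $4$-dimensional absolute-valued real algebra, that is, a $4$-dimensional real vector space endowed with a bilinear product $(x,y)\mapsto xy$ (not assumed associative, commutative or unital) and a norm $\|\cdot\|$ such that $\|xy\|=\|x\|\,\|y\|$ for all $x,y\in A$. Write $(x,y,z)=(xy)z-x(yz)$ for the associator and $x^2=xx$. Let $\mathbb{H}$ be the algebra of real quaternions, and let ${}^*\mathbb{H}$ be the real vector space $\mathbb{H}$ endowed with the product $x\odot y=\overline{x}\,y$, where $x\mapsto\overline{x}$ is the standard conjugation of $\mathbb{H}$. Then the following are equivalent: 1. $(x^2,x,x)=0$ for all $x\in A$; 2. $A$ is isomorphic, as a real algebra, to $\mathbb{H}$ or to ${}^*\mathbb{H}$. -/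

import Mathlib

open scoped Quaternion

/-- An absolute-valued real algebra: a real vector space with a norm and a bilinear product
(not assumed associative, commutative or unital) such that `‖x * y‖ = ‖x‖ * ‖y‖`. -/
class AbsoluteValuedAlgebra (A : Type*) [NormedAddCommGroup A] [NormedSpace ℝ A] [Mul A] :
    Prop where
  add_mul : ∀ x y z : A, (x + y) * z = x * z + y * z
  mul_add : ∀ x y z : A, x * (y + z) = x * y + x * z
  smul_mul : ∀ (r : ℝ) (x y : A), (r • x) * y = r • (x * y)
  mul_smul : ∀ (r : ℝ) (x y : A), x * (r • y) = r • (x * y)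
  norm_mul : ∀ x y : A, ‖x * y‖ = ‖x‖ * ‖y‖

/-- The associator `(x, y, z) = (xy)z - x(yz)`. -/
def algAssociator {A : Type*} [AddGroup A] [Mul A] (x y z : A) : A :=
  (x * y) * z - x * (y * z)

/-- Two (nonassociative, not necessarily unital) real algebras are isomorphic if there is a
multiplicative linear bijection between them. -/
def AlgIsomorphic (A B : Type*) [AddCommGroup A] [Module ℝ A] [Mul A]
    [AddCommGroup B] [Module ℝ B] [Mul B] : Prop :=
  ∃ f : A ≃ₗ[ℝ] B, ∀ x y : A, f (x * y) = f x * f y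

/-- The standard isotope `*ℍ`: the normed space of the real quaternions, with product
`x ⊙ y = x̄ y`. -/
def StarQuaternion : Type := ℍ[ℝ]

namespace StarQuaternion

/-- The identity map from `ℍ` to `*ℍ`. -/
def of (x : ℍ[ℝ]) : StarQuaternion := x

/-- The identity map from `*ℍ` to `ℍ`. -/
def toQuaternion (x : StarQuaternion) : ℍ[ℝ] := x

noncomputable instance : NormedAddCommGroup StarQuaternion :=
  inferInstanceAs (NormedAddCommGroup ℍ[ℝ])

noncomputable instance : NormedSpace ℝ StarQuaternion :=
  inferInstanceAs (NormedSpace ℝ ℍ[ℝ])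

noncomputable instance : Mul StarQuaternion :=
  ⟨fun x y => of (star x.toQuaternion * y.toQuaternion)⟩

end StarQuaternion

instance : AbsoluteValuedAlgebra ℍ[ℝ] where
  add_mul := _root_.add_mul
  mul_add := _root_.mul_add
  smul_mul := smul_mul_assoc
  mul_smul := mul_smul_comm
  norm_mul := _root_.norm_mul

instance : AbsoluteValuedAlgebra StarQuaternion where
  add_mul x y z := by
    change star (x.toQuaternion + y.toQuaternion) * z.toQuaternion =
      star x.toQuaternion * z.toQuaternion + star y.toQuaternion * z.toQuaternion
    rw [star_add, _root_.add_mul]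
  mul_add x y z := _root_.mul_add (star x.toQuaternion) y.toQuaternion z.toQuaternion
  smul_mul r x y := by
    change star (r • x.toQuaternion) * y.toQuaternion =
      r • (star x.toQuaternion * y.toQuaternion)
    rw [Quaternion.star_smul, smul_mul_assoc]
  mul_smul r x y := mul_smul_comm r (star x.toQuaternion) y.toQuaternion
  norm_mul x y := by
    change ‖star x.toQuaternion * y.toQuaternion‖ = ‖x.toQuaternion‖ * ‖y.toQuaternion‖
    rw [_root_.norm_mul, norm_star]

/-! The norm is Euclidean by an averaging argument. For a nonzero functional `f`, the integral of `f
(x * y) ^ 2` over `y` in the unit ball is quadratic in `x`; left multiplication by a unit vector is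
an isometry and preserves Haar measure, so the integral is a positive constant times `‖x‖ ^ 2`.
Hence the parallelogram law holds.

Kaplansky's trick makes the product unital by composing its arguments with inverse translations, and
a four-dimensional unital composition algebra is `ℍ`. So the product of `A` is `φ x * ψ y` on `ℍ`
with `φ`, `ψ` isometries. By Cartan–Dieudonné each of these is `p x q` or `p x̄ q`, which leaves
four families with unit parameters `a`, `b` (`exists_normalForm`).

The identity is then tested at `1`, `a`, `b`, `w` and `1 + w`, where `w` is a unit orthogonal to
`1`, `a`, `b`. Two families are excluded; in the other two `a` and `b` are `±1`, and the sign is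
absorbed by `F ↦ -F`. -/

/-! ### Multiplicative norms are Euclidean -/

section Parallelogram

open MeasureTheory

variable {V : Type*} [NormedAddCommGroup V] [NormedSpace ℝ V] [FiniteDimensional ℝ V]

/-- Linear isometries of a finite-dimensional normed space preserve every Haar measure. -/
theorem LinearIsometryEquiv.measurePreserving_addHaar [MeasurableSpace V] [BorelSpace V]
    (μ : Measure V) [μ.IsAddHaarMeasure] (e : V ≃ₗᵢ[ℝ] V) : MeasurePreserving e μ μ := by
  refine ⟨e.continuous.measurable, ?_⟩
  have hdet : LinearMap.det (e.toLinearEquiv : V →ₗ[ℝ] V) ≠ 0 := e.toLinearEquiv.isUnit_det'.ne_zero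
  have hmap := Measure.map_linearMap_addHaar_eq_smul_addHaar μ hdet
  have hmap' : Measure.map e μ =
      ENNReal.ofReal |(LinearMap.det (e.toLinearEquiv : V →ₗ[ℝ] V))⁻¹| • μ := hmap
  -- The isometry preserves the unit ball, whose measure is positive and finite, so the scaling
  -- factor is 1.
  have hball := congrArg (fun ν : Measure V => ν (Metric.ball 0 1)) hmap'
  simp only [Measure.smul_apply, smul_eq_mul] at hball
  rw [Measure.map_apply e.continuous.measurable Metric.isOpen_ball.measurableSet,
    e.preimage_ball, map_zero] at hball
  have hpos : μ (Metric.ball 0 1) ≠ 0 := (Metric.measure_ball_pos μ 0 one_pos).ne'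
  have hfin : μ (Metric.ball 0 1) ≠ ⊤ := measure_ball_lt_top.ne
  have hone : ENNReal.ofReal |(LinearMap.det (e.toLinearEquiv : V →ₗ[ℝ] V))⁻¹| = 1 :=
    (ENNReal.mul_left_inj hpos hfin).1 (by rw [← hball, one_mul])
  rw [hmap', hone, one_smul]

theorem integrableOn_ball_sq [MeasurableSpace V] [BorelSpace V]
    (μ : Measure V) [μ.IsAddHaarMeasure] (f : V →ₗ[ℝ] ℝ) :
    IntegrableOn (fun y => f y ^ 2) (Metric.ball 0 1) μ := by
  have hf : Continuous fun y => f y ^ 2 := f.continuous_of_finiteDimensional.pow 2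
  exact (hf.continuousOn.integrableOn_compact (isCompact_closedBall (0 : V) 1)).mono_set
    Metric.ball_subset_closedBall

theorem integral_ball_sq_pos [MeasurableSpace V] [BorelSpace V]
    (μ : Measure V) [μ.IsAddHaarMeasure] (f : V →ₗ[ℝ] ℝ) (hf : f ≠ 0) :
    0 < ∫ y in Metric.ball 0 1, f y ^ 2 ∂μ := by
  have hc : Continuous fun y => f y ^ 2 := f.continuous_of_finiteDimensional.pow 2
  rw [setIntegral_pos_iff_support_of_nonneg_ae (.of_forall fun y => sq_nonneg _)
    (integrableOn_ball_sq μ f)]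
  refine (hc.isOpen_support.inter Metric.isOpen_ball).measure_pos μ ?_
  obtain ⟨v, hv⟩ : ∃ v, f v ≠ 0 := by
    by_contra! h
    exact hf (LinearMap.ext h)
  have hv0 : 0 < 1 + ‖v‖ := by positivity
  refine ⟨(1 + ‖v‖)⁻¹ • v, ?_, ?_⟩
  · simp [hv, hv0.ne']
  · rw [mem_ball_zero_iff, norm_smul, norm_inv, Real.norm_of_nonneg hv0.le, inv_mul_lt_iff₀ hv0]
    linarith

theorem integral_ball_sq_comp [MeasurableSpace V] [BorelSpace V]
    (μ : Measure V) [μ.IsAddHaarMeasure] (f : V →ₗ[ℝ] ℝ) (e : V ≃ₗᵢ[ℝ] V) :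
    ∫ y in Metric.ball 0 1, f (e y) ^ 2 ∂μ = ∫ y in Metric.ball 0 1, f y ^ 2 ∂μ := by
  have h := (e.measurePreserving_addHaar μ).setIntegral_preimage_emb
    e.toHomeomorph.measurableEmbedding (fun y => f y ^ 2) (Metric.ball 0 1)
  rwa [e.preimage_ball, map_zero] at h

/-- A finite-dimensional normed space with a bilinear product for which the norm is multiplicative
satisfies the parallelogram law. -/
theorem innerProductSpaceable_of_norm_mul (m : V →ₗ[ℝ] V →ₗ[ℝ] V)
    (hm : ∀ x y, ‖m x y‖ = ‖x‖ * ‖y‖) : InnerProductSpaceable V := by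
  rcases subsingleton_or_nontrivial V with hV | hV
  · exact ⟨fun x y => by simp [Subsingleton.elim x 0, Subsingleton.elim y 0]⟩
  borelize V
  let μ : Measure V := Measure.addHaar
  obtain ⟨v, hv⟩ := exists_ne (0 : V)
  obtain ⟨f, hf⟩ : ∃ f : Module.Dual ℝ V, f v ≠ 0 := by
    by_contra! h
    exact hv ((Module.forall_dual_apply_eq_zero_iff ℝ v).1 h)
  have hf0 : f ≠ 0 := fun h => hf (by simp [h])
  have key : ∀ x, ∫ y in Metric.ball 0 1, f (m x y) ^ 2 ∂μ =
      ‖x‖ ^ 2 * ∫ y in Metric.ball 0 1, f y ^ 2 ∂μ := by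
    intro x
    rcases eq_or_ne x 0 with rfl | hx
    · simp
    have hx' : ‖x‖ ≠ 0 := norm_ne_zero_iff.2 hx
    let e : V →ₗᵢ[ℝ] V := ⟨m (‖x‖⁻¹ • x), fun y => by
      rw [hm, norm_smul, norm_inv, norm_norm, inv_mul_cancel₀ hx', one_mul]⟩
    rw [← integral_ball_sq_comp μ f (e.toLinearIsometryEquiv rfl), ← integral_const_mul]
    congr 1 with y
    have : m x y = ‖x‖ • e y := by
      change m x y = ‖x‖ • m (‖x‖⁻¹ • x) y
      rw [map_smul, LinearMap.smul_apply, smul_smul, mul_inv_cancel₀ hx', one_smul]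
    rw [this, map_smul, smul_eq_mul, mul_pow]
    rfl
  have hI : ∀ x, IntegrableOn (fun y => f (m x y) ^ 2) (Metric.ball 0 1) μ :=
    fun x => integrableOn_ball_sq μ (f ∘ₗ m x)
  refine ⟨fun x y => ?_⟩
  -- The integrands satisfy the parallelogram identity pointwise, by linearity of `f (m x z)` in
  -- `x`.
  have hsum : (‖x + y‖ ^ 2 + ‖x - y‖ ^ 2) * ∫ y in Metric.ball 0 1, f y ^ 2 ∂μ =
      (2 * (‖x‖ ^ 2 + ‖y‖ ^ 2)) * ∫ y in Metric.ball 0 1, f y ^ 2 ∂μ := by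
    rw [add_mul, mul_assoc, add_mul, ← key, ← key, ← key, ← key,
      ← integral_add (hI _) (hI _), ← integral_add (hI _) (hI _), ← integral_const_mul]
    congr 1 with z
    simp only [map_add, map_sub, LinearMap.add_apply, LinearMap.sub_apply]
    ring
  have := mul_right_cancel₀ (integral_ball_sq_pos μ f hf0).ne' hsum
  simpa only [pow_two] using this

end Parallelogram

/-! ### Isometries of the quaternions -/

section Isometries

open scoped RealInnerProductSpace

theorem Quaternion.star_eq_inv_of_norm_eq_one {a : ℍ[ℝ]} (ha : ‖a‖ = 1) : star a = a⁻¹ := by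
  refine eq_inv_of_mul_eq_one_left ?_
  rw [Quaternion.star_mul_self, Quaternion.normSq_eq_norm_mul_self, ha]
  simp

/-- The reflection in the hyperplane orthogonal to a unit quaternion. -/
theorem Quaternion.reflection_orthogonal_singleton {v : ℍ[ℝ]} (hv : ‖v‖ = 1) (x : ℍ[ℝ]) :
    (ℝ ∙ v)ᗮ.reflection x = -(v * star x * v) := by
  rw [Submodule.reflection_orthogonal_apply, Submodule.reflection_singleton_apply, neg_inj]
  have hadd : v * star x + x * star v = ((2 * ⟪v, x⟫ : ℝ) : ℍ[ℝ]) := by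
    have h := Quaternion.self_add_star (v * star x)
    rw [star_mul, star_star] at h
    rw [h, Quaternion.inner_def]
    push_cast
    rfl
  have hvv : star v * v = 1 := by
    rw [Quaternion.star_mul_self, Quaternion.normSq_eq_norm_mul_self, hv]
    simp
  rw [eq_sub_of_add_eq hadd, sub_mul, mul_assoc, hvv, mul_one, Quaternion.coe_mul_eq_smul]
  simp [hv, two_smul, add_smul, two_mul]

/-- Every linear isometry of `ℍ` is `x ↦ p x q` or `x ↦ p x̄ q` for unit quaternions `p`, `q`. -/
theorem Quaternion.exists_eq_mul_mul_or_mul_star_mul (φ : ℍ[ℝ] ≃ₗᵢ[ℝ] ℍ[ℝ]) :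
    ∃ p q : ℍ[ℝ], ‖p‖ = 1 ∧ ‖q‖ = 1 ∧
      ((∀ x, φ x = p * x * q) ∨ (∀ x, φ x = p * star x * q)) := by
  have hmul (f g : ℍ[ℝ] ≃ₗᵢ[ℝ] ℍ[ℝ]) (x : ℍ[ℝ]) : (f * g) x = f (g x) := rfl
  -- Cartan–Dieudonné: every isometry is a product of hyperplane reflections.
  obtain ⟨l, -, rfl⟩ := φ.reflections_generate_dim
  induction l with
  | nil => exact ⟨1, 1, norm_one, norm_one, .inl fun x => by simp⟩
  | cons v l ih =>
    obtain ⟨p, q, hp, hq, h⟩ := ih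
    rcases eq_or_ne v 0 with rfl | hv
    · refine ⟨p, q, hp, hq, ?_⟩
      have hrefl (x : ℍ[ℝ]) : (ℝ ∙ (0 : ℍ[ℝ]))ᗮ.reflection x = x :=
        Submodule.reflection_mem_subspace_eq_self (by simp)
      simpa only [List.map_cons, List.prod_cons, hmul, hrefl] using h
    have hv' : ‖v‖ ≠ 0 := norm_ne_zero_iff.2 hv
    have hspan : (ℝ ∙ v) = ℝ ∙ (‖v‖⁻¹ • v) :=
      (Submodule.span_singleton_smul_eq (IsUnit.mk0 _ (inv_ne_zero hv')) v).symm
    have hu : ‖‖v‖⁻¹ • v‖ = 1 := by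
      rw [norm_smul, norm_inv, norm_norm, inv_mul_cancel₀ hv']
    set u := ‖v‖⁻¹ • v
    -- From `-(u * star (p x q) * u) = -(u q̄) x̄ (p̄ u)`: each reflection exchanges the two forms.
    refine ⟨-(u * star q), star p * u, by rw [norm_neg, norm_mul, norm_star, hu, hq, one_mul],
      by rw [norm_mul, norm_star, hu, hp, one_mul], ?_⟩
    simp only [List.map_cons, List.prod_cons, hmul, hspan,
      Quaternion.reflection_orthogonal_singleton hu]
    rcases h with h | h
    · right
      intro x
      rw [h]
      simp [mul_assoc]
    · left
      intro x
      rw [h]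
      simp [mul_assoc]

end Isometries

/-! ### Unital composition algebras of dimension four -/

section UnitalComposition

open scoped RealInnerProductSpace

variable {V : Type*} [NormedAddCommGroup V] [InnerProductSpace ℝ V] {m : V →ₗ[ℝ] V →ₗ[ℝ] V}
  {e : V}

theorem inner_mul_left_left (hm : ∀ x y, ‖m x y‖ = ‖x‖ * ‖y‖) (x y z : V) :
    ⟪m x y, m x z⟫ = ‖x‖ ^ 2 * ⟪y, z⟫ := by
  rw [real_inner_eq_norm_add_mul_self_sub_norm_mul_self_sub_norm_mul_self_div_two,
    real_inner_eq_norm_add_mul_self_sub_norm_mul_self_sub_norm_mul_self_div_two, ← map_add,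
    hm, hm, hm]
  ring

/-- Linearization of `inner_mul_left_left` in the left factor. -/
theorem inner_mul_add_inner_mul (hm : ∀ x y, ‖m x y‖ = ‖x‖ * ‖y‖) (x w y z : V) :
    ⟪m x y, m w z⟫ + ⟪m w y, m x z⟫ = 2 * ⟪x, w⟫ * ⟪y, z⟫ := by
  have h := inner_mul_left_left hm (x + w) y z
  simp only [map_add, LinearMap.add_apply, inner_add_left, inner_add_right,
    inner_mul_left_left hm, norm_add_sq_real] at h
  linarith

/-- Left multiplication by an element orthogonal to the unit squares to a negative scalar. -/
theorem mul_mul_self_of_inner_eq_zero (hm : ∀ x y, ‖m x y‖ = ‖x‖ * ‖y‖) (he : ∀ x, m e x = x)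
    {x : V} (hx : ⟪x, e⟫ = 0) (y : V) : m x (m x y) = -(‖x‖ ^ 2 • y) := by
  refine ext_inner_right ℝ fun z => ?_
  -- Taking `w = e` expresses that left multiplication by `x ⊥ e` is skew-adjoint.
  have h := inner_mul_add_inner_mul hm x e (m x y) z
  rw [he, he, hx, inner_mul_left_left hm] at h
  rw [inner_neg_left, real_inner_smul_left]
  linarith

/-- Fewer than `dim V` vectors have a common unit normal vector. -/
theorem exists_norm_eq_one_forall_inner_eq_zero [FiniteDimensional ℝ V] (s : Finset V)
    (hs : s.card < Module.finrank ℝ V) : ∃ v : V, ‖v‖ = 1 ∧ ∀ w ∈ s, ⟪v, w⟫ = 0 := by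
  have hlt : Submodule.span ℝ (s : Set V) < ⊤ := by
    refine lt_top_iff_ne_top.2 fun h => ?_
    have := finrank_span_finset_le_card (R := ℝ) s
    rw [Set.finrank, h, finrank_top] at this
    omega
  obtain ⟨v, hv, hv0⟩ := (Submodule.ne_bot_iff _).1
    (mt (Submodule.orthogonal_eq_bot_iff).1 hlt.ne)
  have hn : ‖v‖ ≠ 0 := norm_ne_zero_iff.2 hv0
  refine ⟨‖v‖⁻¹ • v, by rw [norm_smul, norm_inv, norm_norm, inv_mul_cancel₀ hn], fun w hw => ?_⟩
  rw [real_inner_smul_left, Submodule.inner_left_of_mem_orthogonal (Submodule.subset_span hw) hv,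
    mul_zero]

/-- A four-dimensional real inner product space with a unital bilinear product for which the norm
is multiplicative is isometrically isomorphic to the quaternions. -/
theorem exists_linearIsometryEquiv_quaternion (hm : ∀ x y, ‖m x y‖ = ‖x‖ * ‖y‖)
    (hl : ∀ x, m e x = x) (hr : ∀ x, m x e = x) (hdim : Module.finrank ℝ V = 4) :
    ∃ F : V ≃ₗᵢ[ℝ] ℍ[ℝ], ∀ x y, F (m x y) = F x * F y := by
  have : FiniteDimensional ℝ V := Module.finite_of_finrank_eq_succ hdim
  have : Nontrivial V := Module.nontrivial_of_finrank_eq_succ hdim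
  have hflip : ∀ x y, ‖m.flip x y‖ = ‖x‖ * ‖y‖ := fun x y => by
    rw [LinearMap.flip_apply, hm, mul_comm]
  have hee : ‖e‖ = 1 := by
    obtain ⟨v, hv⟩ := exists_ne (0 : V)
    have := hm e v
    rw [hl] at this
    exact (mul_eq_right₀ (norm_ne_zero_iff.2 hv)).1 this.symm
  have hL : ∀ {x : V}, ⟪x, e⟫ = 0 → ∀ y, m x (m x y) = -(‖x‖ ^ 2 • y) :=
    fun hx y => mul_mul_self_of_inner_eq_zero hm hl hx y
  have hR : ∀ {x : V}, ⟪x, e⟫ = 0 → ∀ y, m (m y x) x = -(‖x‖ ^ 2 • y) :=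
    fun hx y => mul_mul_self_of_inner_eq_zero hflip hr hx y
  have hsq : ∀ {x : V}, ⟪x, e⟫ = 0 → m x x = -(‖x‖ ^ 2 • e) := fun {x} hx => by
    simpa only [hr] using hL hx e
  have hanti : ∀ {x y : V}, ⟪x, e⟫ = 0 → ⟪y, e⟫ = 0 → ⟪x, y⟫ = 0 → m y x = -m x y := by
    intro x y hx hy hxy
    have h := hsq (x := x + y) (by rw [inner_add_left, hx, hy, add_zero])
    simp only [map_add, LinearMap.add_apply, hsq hx, hsq hy, norm_add_sq_real, hxy, mul_zero,
      add_zero, add_smul] at h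
    rw [← sub_eq_zero] at h ⊢
    rw [← h]
    abel
  classical
  -- An orthonormal basis `e, i, j, k = ij` is built; skewness and anticommutation give the
  -- quaternion table.
  obtain ⟨i, hi, hie⟩ := exists_norm_eq_one_forall_inner_eq_zero {e} (by simp [hdim])
  replace hie : ⟪i, e⟫ = 0 := hie e (by simp)
  obtain ⟨j, hj, hj'⟩ := exists_norm_eq_one_forall_inner_eq_zero {e, i}
    (Finset.card_le_two.trans_lt (by rw [hdim]; norm_num))
  have hje : ⟪j, e⟫ = 0 := hj' e (by simp)
  have hij : ⟪i, j⟫ = 0 := by rw [real_inner_comm]; exact hj' i (by simp)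
  obtain ⟨k, hk⟩ : ∃ k, k = m i j := ⟨_, rfl⟩
  have hkn : ‖k‖ = 1 := by rw [hk, hm, hi, hj, one_mul]
  have hii : m i i = -e := by rw [hsq hie, hi]; simp
  have hjj : m j j = -e := by rw [hsq hje, hj]; simp
  have hik : m i k = -j := by rw [hk, hL hie, hi]; simp
  have hkj : m k j = -i := by rw [hk, hR hje, hj]; simp
  have hke : ⟪k, e⟫ = 0 := by
    have h := inner_mul_left_left hm i j i
    rw [← hk, hii, inner_neg_right, real_inner_comm, real_inner_comm i j, hij, mul_zero] at h
    rw [real_inner_comm]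
    linarith
  have hik0 : ⟪i, k⟫ = 0 := by
    have h := inner_mul_left_left hm i e j
    rwa [hr, ← hk, real_inner_comm j e, hje, mul_zero] at h
  have hjk0 : ⟪j, k⟫ = 0 := by
    have h := inner_mul_left_left hflip j e i
    rwa [LinearMap.flip_apply, LinearMap.flip_apply, hl, ← hk, real_inner_comm i e, hie,
      mul_zero] at h
  have hkk : m k k = -e := by rw [hsq hke, hkn]; simp
  have hji : m j i = -k := by rw [hanti hie hje hij, hk]
  have hki : m k i = j := by rw [hanti hie hke hik0, hik, neg_neg]
  have hjk : m j k = i := by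
    rw [hanti hke hje (by rw [real_inner_comm]; exact hjk0), hkj, neg_neg]
  let G : ℍ[ℝ] →ₗ[ℝ] V :=
    { toFun := fun x => x.re • e + x.imI • i + x.imJ • j + x.imK • k
      map_add' := fun x y => by simp only [Quaternion.re_add, Quaternion.imI_add,
        Quaternion.imJ_add, Quaternion.imK_add]; module
      map_smul' := fun r x => by simp only [Quaternion.re_smul, Quaternion.imI_smul,
        Quaternion.imJ_smul, Quaternion.imK_smul, smul_eq_mul, RingHom.id_apply]; module }
  have hG : ∀ x, G x = x.re • e + x.imI • i + x.imJ • j + x.imK • k := fun _ => rfl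
  have hself : ∀ {v : V}, ‖v‖ = 1 → ⟪v, v⟫ = 1 := fun hv => by
    rw [real_inner_self_eq_norm_sq, hv, one_pow]
  have hei : ⟪e, i⟫ = 0 := by rw [real_inner_comm, hie]
  have hej : ⟪e, j⟫ = 0 := by rw [real_inner_comm, hje]
  have hek : ⟪e, k⟫ = 0 := by rw [real_inner_comm, hke]
  have hji0 : ⟪j, i⟫ = 0 := by rw [real_inner_comm, hij]
  have hki0 : ⟪k, i⟫ = 0 := by rw [real_inner_comm, hik0]
  have hkj0 : ⟪k, j⟫ = 0 := by rw [real_inner_comm, hjk0]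
  have hGn : ∀ x, ‖G x‖ = ‖x‖ := by
    intro x
    refine (sq_eq_sq₀ (norm_nonneg _) (norm_nonneg _)).1 ?_
    rw [← real_inner_self_eq_norm_sq, ← real_inner_self_eq_norm_sq, Quaternion.inner_self,
      Quaternion.normSq_def', hG]
    simp only [inner_add_left, inner_add_right, real_inner_smul_left, real_inner_smul_right, hie,
      hje, hke, hij, hik0, hjk0, hei, hej, hek, hji0, hki0, hkj0, hself hee, hself hi, hself hj,
      hself hkn]
    ring
  have hGm : ∀ x y, G (x * y) = m (G x) (G y) := by
    intro x y
    simp only [hG, Quaternion.re_mul, Quaternion.imI_mul, Quaternion.imJ_mul, Quaternion.imK_mul,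
      map_add, map_smul, LinearMap.add_apply, LinearMap.smul_apply, hl, hr, hii, hjj, hkk, hik,
      hkj, hji, hki, hjk, ← hk]
    module
  let E : ℍ[ℝ] ≃ₗᵢ[ℝ] V := LinearIsometry.toLinearIsometryEquiv ⟨G, hGn⟩
    (by rw [hdim, Quaternion.finrank_eq_four])
  refine ⟨E.symm, fun x y => E.injective ?_⟩
  rw [E.apply_symm_apply]
  change m x y = G (E.symm x * E.symm y)
  rw [hGm]
  change m x y = m (E (E.symm x)) (E (E.symm y))
  rw [E.apply_symm_apply, E.apply_symm_apply]

end UnitalComposition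

/-! ### Isotopes of the quaternions and four normal forms -/

section NormalForm

/-- A four-dimensional absolute-valued algebra is an isotope of `ℍ` by linear isometries. -/
theorem AbsoluteValuedAlgebra.exists_isotopy_quaternion (A : Type*) [NormedAddCommGroup A]
    [NormedSpace ℝ A] [Mul A] [AbsoluteValuedAlgebra A] (hdim : Module.finrank ℝ A = 4) :
    ∃ (F : A ≃ₗᵢ[ℝ] ℍ[ℝ]) (φ ψ : ℍ[ℝ] ≃ₗᵢ[ℝ] ℍ[ℝ]), ∀ x y : A, F (x * y) = φ (F x) * ψ (F y) := by
  have : FiniteDimensional ℝ A := Module.finite_of_finrank_eq_succ hdim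
  have : Nontrivial A := Module.nontrivial_of_finrank_eq_succ hdim
  let M : A →ₗ[ℝ] A →ₗ[ℝ] A := LinearMap.mk₂ ℝ (· * ·) AbsoluteValuedAlgebra.add_mul
    AbsoluteValuedAlgebra.smul_mul AbsoluteValuedAlgebra.mul_add
    fun r x y => AbsoluteValuedAlgebra.mul_smul r x y
  have hM : ∀ x y, ‖M x y‖ = ‖x‖ * ‖y‖ := AbsoluteValuedAlgebra.norm_mul
  have hpar := (innerProductSpaceable_of_norm_mul M hM).parallelogram_identity
  let _ : InnerProductSpace ℝ A := InnerProductSpace.ofNorm (𝕜 := ℝ) hpar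
  obtain ⟨a, ha⟩ : ∃ a : A, ‖a‖ = 1 := exists_norm_eq A zero_le_one
  let L : A ≃ₗᵢ[ℝ] A := LinearIsometry.toLinearIsometryEquiv
    ⟨M a, fun x => by rw [hM, ha, one_mul]⟩ rfl
  let R : A ≃ₗᵢ[ℝ] A := LinearIsometry.toLinearIsometryEquiv
    ⟨M.flip a, fun x => by rw [LinearMap.flip_apply, hM, ha, mul_one]⟩ rfl
  have hL : ∀ x, L x = a * x := fun _ => rfl
  have hR : ∀ x, R x = x * a := fun _ => rfl
  -- Kaplansky's isotope, with unit `a * a`; the original product is `m (R x) (L y)`.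
  let m : A →ₗ[ℝ] A →ₗ[ℝ] A := M.compl₁₂ (R.symm.toLinearEquiv : A →ₗ[ℝ] A)
    (L.symm.toLinearEquiv : A →ₗ[ℝ] A)
  have hm : ∀ x y, m x y = R.symm x * L.symm y := fun _ _ => rfl
  have hRa : R.symm (a * a) = a := by rw [← hR, R.symm_apply_apply]
  have hLa : L.symm (a * a) = a := by rw [← hL, L.symm_apply_apply]
  obtain ⟨F, hF⟩ := exists_linearIsometryEquiv_quaternion (m := m) (e := a * a)
    (fun x y => by
      rw [hm, AbsoluteValuedAlgebra.norm_mul, LinearIsometryEquiv.norm_map,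
        LinearIsometryEquiv.norm_map])
    (fun x => by rw [hm, hRa, ← hL, L.apply_symm_apply])
    (fun x => by rw [hm, hLa, ← hR, R.apply_symm_apply]) hdim
  refine ⟨F, (F.symm.trans R).trans F, (F.symm.trans L).trans F, fun x y => ?_⟩
  simp only [LinearIsometryEquiv.trans_apply, F.symm_apply_apply]
  rw [← hF, hm, R.symm_apply_apply, L.symm_apply_apply]

/-- Multiplication by nonzero quaternions on both sides, as a linear equivalence. -/
noncomputable def Quaternion.mulLeftRight (u v : ℍ[ℝ]) (hu : u ≠ 0) (hv : v ≠ 0) :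
    ℍ[ℝ] ≃ₗ[ℝ] ℍ[ℝ] where
  toFun x := u * x * v
  map_add' x y := by rw [mul_add, add_mul]
  map_smul' r x := by simp
  invFun x := u⁻¹ * x * v⁻¹
  left_inv x := by simp [mul_assoc, hu, hv]
  right_inv x := by simp [mul_assoc, hu, hv]

/-- Every four-dimensional absolute-valued algebra is one of four types of isotopes of `ℍ`. -/
theorem AbsoluteValuedAlgebra.exists_normalForm (A : Type*) [NormedAddCommGroup A]
    [NormedSpace ℝ A] [Mul A] [AbsoluteValuedAlgebra A] (hdim : Module.finrank ℝ A = 4) :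
    ∃ (F : A ≃ₗ[ℝ] ℍ[ℝ]) (a b : ℍ[ℝ]), ‖a‖ = 1 ∧ ‖b‖ = 1 ∧
      ((∀ x y, F (x * y) = a * F x * F y * b) ∨
       (∀ x y, F (x * y) = star (F x) * a * F y * b) ∨
       (∀ x y, F (x * y) = a * F x * b * star (F y)) ∨
       (∀ x y, F (x * y) = a * star (F x) * star (F y) * b)) := by
  obtain ⟨F, φ, ψ, hF⟩ := AbsoluteValuedAlgebra.exists_isotopy_quaternion A hdim
  obtain ⟨p, q₁, hp, hq₁, hφ⟩ := Quaternion.exists_eq_mul_mul_or_mul_star_mul φ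
  obtain ⟨q₂, r, hq₂, hr, hψ⟩ := Quaternion.exists_eq_mul_mul_or_mul_star_mul ψ
  obtain ⟨q, hq⟩ : ∃ q, q = q₁ * q₂ := ⟨_, rfl⟩
  have hqn : ‖q‖ = 1 := by rw [hq, norm_mul, hq₁, hq₂, one_mul]
  have hp0 : p ≠ 0 := norm_ne_zero_iff.1 (hp ▸ one_ne_zero)
  have hq0 : q ≠ 0 := norm_ne_zero_iff.1 (hqn ▸ one_ne_zero)
  have hr0 : r ≠ 0 := norm_ne_zero_iff.1 (hr ▸ one_ne_zero)
  have hps := Quaternion.star_eq_inv_of_norm_eq_one hp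
  have hqs := Quaternion.star_eq_inv_of_norm_eq_one hqn
  have hrs := Quaternion.star_eq_inv_of_norm_eq_one hr
  have happ (u v : ℍ[ℝ]) (hu : u ≠ 0) (hv : v ≠ 0) (x : A) :
      (F.toLinearEquiv.trans (Quaternion.mulLeftRight u v hu hv)) x = u * F x * v := rfl
  -- In each case `F` is multiplied on one side by a unit quaternion that absorbs one of `p`, `q`,
  -- `r`: respectively `q`, `r`, `p`, `q`.
  rcases hφ with hφ | hφ <;> rcases hψ with hψ | hψ
  · have hF' (x y : A) : F (x * y) = p * F x * q * F y * r := by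
      rw [hF, hφ, hψ, hq]; simp only [mul_assoc]
    refine ⟨F.toLinearEquiv.trans (Quaternion.mulLeftRight 1 q one_ne_zero hq0), p, q⁻¹ * r * q,
      hp, by simp [hqn, hr], .inl fun x y => ?_⟩
    simp [happ, hF', mul_assoc, hq0]
  · have hF' (x y : A) : F (x * y) = p * F x * q * star (F y) * r := by
      rw [hF, hφ, hψ, hq]; simp only [mul_assoc]
    refine ⟨F.toLinearEquiv.trans (Quaternion.mulLeftRight 1 r⁻¹ one_ne_zero (inv_ne_zero hr0)), p,
      r * q * r⁻¹, hp, by simp [hqn, hr], .inr (.inr (.inl fun x y => ?_))⟩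
    simp [happ, hF', mul_assoc, hr0, hrs]
  · have hF' (x y : A) : F (x * y) = p * star (F x) * q * F y * r := by
      rw [hF, hφ, hψ, hq]; simp only [mul_assoc]
    refine ⟨F.toLinearEquiv.trans (Quaternion.mulLeftRight p⁻¹ 1 (inv_ne_zero hp0) one_ne_zero),
      p⁻¹ * q * p, r, by simp [hqn, hp], hr, .inr (.inl fun x y => ?_)⟩
    simp [happ, hF', mul_assoc, hp0, hps]
  · have hF' (x y : A) : F (x * y) = p * star (F x) * q * star (F y) * r := by
      rw [hF, hφ, hψ, hq]; simp only [mul_assoc]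
    refine ⟨F.toLinearEquiv.trans (Quaternion.mulLeftRight q⁻¹ 1 (inv_ne_zero hq0) one_ne_zero),
      q⁻¹ * p, q⁻¹ * r, by simp [hqn, hp], by simp [hqn, hr], .inr (.inr (.inr fun x y => ?_))⟩
    simp [happ, hF', mul_assoc, hq0, hqs]

end NormalForm

/-! ### The identity tested on each normal form -/

section Identities

open scoped RealInnerProductSpace

/-- A unit imaginary quaternion `w` orthogonal to `a` and `b` satisfies `w a = ā w` and
`w b = b̄ w`. -/
theorem Quaternion.exists_mul_self_eq_neg_one_mul_eq_star_mul (a b : ℍ[ℝ]) :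
    ∃ w : ℍ[ℝ], w * w = -1 ∧ star w = -w ∧ w * a = star a * w ∧ w * b = star b * w := by
  classical
  obtain ⟨w, hw, h⟩ := exists_norm_eq_one_forall_inner_eq_zero {1, a, b}
    (Finset.card_le_three.trans_lt (by rw [Quaternion.finrank_eq_four]; norm_num))
  have hws : star w = -w := by
    have h1 : ⟪w, 1⟫ = 0 := h 1 (by simp)
    rw [Quaternion.inner_def, star_one, mul_one] at h1
    exact Quaternion.star_eq_neg.2 h1
  have hcomm (c : ℍ[ℝ]) (hc : ⟪w, c⟫ = 0) : w * c = star c * w := by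
    rw [real_inner_comm, Quaternion.inner_def] at hc
    have hre : (c * star w).re = 0 := hc
    have hre' : (star w * c).re = 0 := by
      simp only [Quaternion.re_mul] at hre ⊢
      linarith
    have hst := Quaternion.star_eq_neg.2 hre'
    rw [star_mul, star_star, hws, neg_mul, neg_neg] at hst
    exact hst.symm
  have hww := Quaternion.star_eq_inv_of_norm_eq_one hw
  have hw0 : w ≠ 0 := norm_ne_zero_iff.1 (hw ▸ one_ne_zero)
  refine ⟨w, ?_, hws, hcomm a (h a (by simp)), hcomm b (h b (by simp))⟩
  rw [hws] at hww
  rw [← neg_eq_iff_eq_neg, ← mul_neg, hww, mul_inv_cancel₀ hw0]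

theorem Quaternion.neg_one_ne_one : (-1 : ℍ[ℝ]) ≠ 1 := fun h => by
  have hre := congrArg QuaternionAlgebra.re h
  norm_num at hre

theorem mul_inv_eq_mul_of_mul_eq_inv_mul {K : Type*} [DivisionRing K] {w a : K} (ha : a ≠ 0)
    (h : w * a = a⁻¹ * w) : w * a⁻¹ = a * w := by
  rw [mul_inv_eq_iff_eq_mul₀ ha, mul_assoc, h, mul_inv_cancel_left₀ ha]

theorem eq_one_or_eq_neg_one_of_inv_eq {K : Type*} [DivisionRing K] {a : K} (ha : a ≠ 0)
    (h : a⁻¹ = a) : a = 1 ∨ a = -1 := by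
  refine mul_self_eq_one_iff.1 ?_
  nth_rw 1 [← h]
  exact inv_mul_cancel₀ ha

/-- The identity `(x², x, x) = 0` for a product `P` on `ℍ`. -/
def SquareAssociative (P : ℍ[ℝ] → ℍ[ℝ] → ℍ[ℝ]) : Prop :=
  ∀ x, P (P (P x x) x) x = P (P x x) (P x x)

variable {a b : ℍ[ℝ]}

/-- The value at `1` gives `ab = ba`, the value at `w` then gives `b² = 1`, and the value at `1 +
w`, whose square is `2w`, gives `a⁻¹ = a`. -/
theorem SquareAssociative.eq_one_or_neg_one_of_mul (ha : ‖a‖ = 1) (hb : ‖b‖ = 1)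
    (h : SquareAssociative fun x y => a * x * y * b) : (a = 1 ∨ a = -1) ∧ (b = 1 ∨ b = -1) := by
  have ha0 : a ≠ 0 := norm_ne_zero_iff.1 (ha ▸ one_ne_zero)
  have hb0 : b ≠ 0 := norm_ne_zero_iff.1 (hb ▸ one_ne_zero)
  obtain ⟨w, hww, -, hwa, hwb⟩ := Quaternion.exists_mul_self_eq_neg_one_mul_eq_star_mul a b
  rw [Quaternion.star_eq_inv_of_norm_eq_one ha] at hwa
  rw [Quaternion.star_eq_inv_of_norm_eq_one hb] at hwb
  have hw0 : w ≠ 0 := by rintro rfl; simp at hww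
  have h1 := h 1
  have h2 := h w
  simp only [mul_assoc, mul_one, mul_right_inj' ha0] at h1
  simp [mul_assoc, ha0, hb0, hwb, hww] at h2
  have hab : a * b = b * a := by
    refine mul_right_cancel₀ (mul_ne_zero hb0 hb0) ?_
    simpa [mul_assoc, hb0] using h1
  have hbb : b * b = 1 := by
    have : b * a * (b * b) = b * a * 1 := by rw [mul_one, mul_assoc, ← h2, hab]
    exact mul_left_cancel₀ (mul_ne_zero hb0 ha0) this
  have hb1 : b = 1 ∨ b = -1 := mul_self_eq_one_iff.1 hbb
  refine ⟨eq_one_or_eq_neg_one_of_inv_eq ha0 ?_, hb1⟩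
  have hx : (1 + w) * (1 + w) = (2 : ℝ) • w := by
    simp only [mul_add, add_mul, hww, two_smul, mul_one, one_mul]
    abel
  have hx' (z : ℍ[ℝ]) : (1 + w) * ((1 + w) * z) = (2 : ℝ) • (w * z) := by
    rw [← mul_assoc, hx, smul_mul_assoc]
  have h3 := h (1 + w)
  have hcancel : a * (w * w) = w * (a * w) := by
    rcases hb1 with rfl | rfl <;> simpa [mul_assoc, hx, hx', ha0] using h3
  rw [← mul_assoc w, hwa, mul_assoc, eq_comm] at hcancel
  exact mul_right_cancel₀ (mul_ne_zero hw0 hw0) hcancel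

/-- As before, `1` and `w` give `ab = ba` and `b² = 1`. At `x = 1 + w` the identity becomes `x̄ a x
= x a x̄`, so `w` commutes with `a`; as `w a = a⁻¹ w`, this gives `a⁻¹ = a`. -/
theorem SquareAssociative.eq_one_or_neg_one_of_star_mul (ha : ‖a‖ = 1) (hb : ‖b‖ = 1)
    (h : SquareAssociative fun x y => star x * a * y * b) :
    (a = 1 ∨ a = -1) ∧ (b = 1 ∨ b = -1) := by
  have ha0 : a ≠ 0 := norm_ne_zero_iff.1 (ha ▸ one_ne_zero)
  have hb0 : b ≠ 0 := norm_ne_zero_iff.1 (hb ▸ one_ne_zero)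
  obtain ⟨w, hww, hws, hwa, hwb⟩ := Quaternion.exists_mul_self_eq_neg_one_mul_eq_star_mul a b
  have has := Quaternion.star_eq_inv_of_norm_eq_one ha
  have hbs := Quaternion.star_eq_inv_of_norm_eq_one hb
  rw [has] at hwa
  rw [hbs] at hwb
  have hwa' := mul_inv_eq_mul_of_mul_eq_inv_mul ha0 hwa
  have hw0 : w ≠ 0 := by rintro rfl; simp at hww
  have h1 := h 1
  have h2 := h w
  simp [mul_assoc, ha0, hb0, star_mul, has, hbs] at h1
  simp [mul_assoc, ha0, hb0, star_mul, has, hbs, hws, hwa, hwb, hwa', hww] at h2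
  have hab : a * b = b * a := by
    have hconj : a = b⁻¹ * (a * b) := mul_right_cancel₀ hb0 (h1.trans (by simp only [mul_assoc]))
    exact ((eq_inv_mul_iff_mul_eq₀ hb0).1 hconj).symm
  have hbb : b * b = 1 := by
    have hab' : b⁻¹ * a⁻¹ = a⁻¹ * b⁻¹ := by rw [← mul_inv_rev, ← mul_inv_rev, hab]
    rw [← h2, ← mul_assoc b⁻¹, hab']
    simp [ha0, hb0]
  have hb1 : b = 1 ∨ b = -1 := mul_self_eq_one_iff.1 hbb
  refine ⟨eq_one_or_eq_neg_one_of_inv_eq ha0 ?_, hb1⟩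
  obtain ⟨x, hx⟩ : ∃ x, x = 1 + w := ⟨_, rfl⟩
  have hxs : star x = 1 - w := by rw [hx, star_add, star_one, hws, sub_eq_add_neg]
  have hx0 : x ≠ 0 := by
    intro h0
    rw [eq_neg_of_add_eq_zero_right (hx.symm.trans h0), neg_mul_neg, one_mul] at hww
    exact Quaternion.neg_one_ne_one hww.symm
  have h3 := h x
  have hcancel : star x * a * x = x * a * star x := by
    refine mul_right_cancel₀ (mul_ne_zero ha0 hx0) ?_
    rcases hb1 with rfl | rfl <;> simpa [mul_assoc, ha0, hx0, has] using h3
  rw [hxs, hx] at hcancel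
  have hcomm : (2 : ℝ) • (w * a) = (2 : ℝ) • (a * w) := by
    rw [two_smul, two_smul]
    rw [← sub_eq_zero] at hcancel ⊢
    rw [← neg_eq_zero, ← hcancel]
    noncomm_ring
  have hcomm' := smul_right_injective _ (two_ne_zero' ℝ) hcomm
  rw [hwa] at hcomm'
  exact mul_right_cancel₀ hw0 hcomm'

/-- Comparing the values at `1` and `b` gives `b² = 1`; the value at `b` then gives `a = a⁻¹`, and
the value at `w` would force `-a = a`. -/
theorem not_squareAssociative_mul_star (ha : ‖a‖ = 1) (hb : ‖b‖ = 1) :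
    ¬ SquareAssociative fun x y => a * x * b * star y := by
  intro h
  have ha0 : a ≠ 0 := norm_ne_zero_iff.1 (ha ▸ one_ne_zero)
  have hb0 : b ≠ 0 := norm_ne_zero_iff.1 (hb ▸ one_ne_zero)
  have has := Quaternion.star_eq_inv_of_norm_eq_one ha
  have hbs := Quaternion.star_eq_inv_of_norm_eq_one hb
  obtain ⟨w, hww, hws, hwa, -⟩ := Quaternion.exists_mul_self_eq_neg_one_mul_eq_star_mul a b
  rw [has] at hwa
  have hwa' := mul_inv_eq_mul_of_mul_eq_inv_mul ha0 hwa
  have h1 := h 1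
  have h2 := h b
  have h3 := h w
  simp [mul_assoc, ha0, hb0, star_mul, has, hbs] at h1
  simp [mul_assoc, ha0, hb0, star_mul, has, hbs] at h2
  have hbb : b * b = 1 := by
    have : a * b * (b * b) = a * b * 1 := by rw [mul_one, mul_assoc, h1, h2]
    exact mul_left_cancel₀ (mul_ne_zero ha0 hb0) this
  have haa (h : a = a⁻¹) : a * a = 1 := by
    nth_rw 2 [h]
    exact mul_inv_cancel₀ ha0
  refine Quaternion.neg_one_ne_one (mul_right_cancel₀ ha0 ?_)
  rcases mul_self_eq_one_iff.1 hbb with rfl | rfl <;>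
    simp [mul_assoc, has, hws, hww] at h2 h3 <;>
    simpa [haa h2, ha0, eq_comm] using h3

/-- The value at `w` gives `a⁻¹ = -a`, and then `1` gives `b⁻¹ = -b`. The value at `a` now yields
`(ab)² = -1`, and with this the value at `b` yields `(ab)² = 1`. -/
theorem not_squareAssociative_star_mul_star (ha : ‖a‖ = 1) (hb : ‖b‖ = 1) :
    ¬ SquareAssociative fun x y => a * star x * star y * b := by
  intro h
  have ha0 : a ≠ 0 := norm_ne_zero_iff.1 (ha ▸ one_ne_zero)
  have hb0 : b ≠ 0 := norm_ne_zero_iff.1 (hb ▸ one_ne_zero)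
  obtain ⟨w, hww, hws, hwa, hwb⟩ := Quaternion.exists_mul_self_eq_neg_one_mul_eq_star_mul a b
  have has := Quaternion.star_eq_inv_of_norm_eq_one ha
  have hbs := Quaternion.star_eq_inv_of_norm_eq_one hb
  rw [has] at hwa
  rw [hbs] at hwb
  have hwa' := mul_inv_eq_mul_of_mul_eq_inv_mul ha0 hwa
  have h1 := h 1
  have h2 := h w
  have h3 := h a
  have h4 := h b
  simp [mul_assoc, ha0, hb0, star_mul, has, hbs] at h1 h3 h4
  simp [mul_assoc, star_mul, has, hbs, hws, hwa, hwb, hwa', hww] at h2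
  have ha' : a⁻¹ = -a := by
    refine mul_right_cancel₀ hb0 ?_
    refine mul_left_cancel₀ (mul_ne_zero ha0 (mul_ne_zero (inv_ne_zero hb0)
      (mul_ne_zero (inv_ne_zero ha0) (inv_ne_zero hb0)))) ?_
    rw [neg_mul, mul_neg]
    simpa only [mul_assoc] using h2.symm
  have hb' : b⁻¹ = -b := by
    refine mul_left_cancel₀ (inv_ne_zero ha0)
      (mul_right_cancel₀ (mul_ne_zero (inv_ne_zero ha0) hb0) ?_)
    rw [mul_assoc, mul_assoc, ← h1, ha']
    simp
  simp only [ha', hb', neg_mul, mul_neg, neg_neg] at h3 h4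
  have hbb : b * b = -1 := by rw [← neg_eq_iff_eq_neg, ← mul_neg, ← hb', mul_inv_cancel₀ hb0]
  have habab : a * (b * (a * b)) = -1 := by
    refine mul_left_cancel₀ (mul_ne_zero ha0 hb0) ?_
    rw [mul_neg, mul_one, h3]
    simp only [mul_assoc]
  have h5 : a * (b * (a * b)) = 1 := by
    rw [habab] at h4
    calc a * (b * (a * b)) = a * (b * a) * b := by simp only [mul_assoc]
      _ = 1 := by simp [h4, hbb]
  exact Quaternion.neg_one_ne_one (habab.symm.trans h5)

end Identities

/-! ### Identifying the surviving algebras -/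

section Classification

variable {A : Type*} [NormedAddCommGroup A] [NormedSpace ℝ A] [Mul A]

theorem squareAssociative_of_linearEquiv (h : ∀ x : A, algAssociator (x * x) x x = 0)
    (F : A ≃ₗ[ℝ] ℍ[ℝ]) {P : ℍ[ℝ] → ℍ[ℝ] → ℍ[ℝ]} (hF : ∀ x y, F (x * y) = P (F x) (F y)) :
    SquareAssociative P := by
  intro x
  have hx := congrArg F (sub_eq_zero.1 (h (F.symm x)))
  simpa only [hF, F.apply_symm_apply] using hx

theorem AlgIsomorphic.algAssociator_eq_zero {B : Type*} [AddCommGroup B] [Module ℝ B] [Mul B]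
    (hAB : AlgIsomorphic A B) (hB : ∀ x : B, algAssociator (x * x) x x = 0) (x : A) :
    algAssociator (x * x) x x = 0 := by
  obtain ⟨f, hf⟩ := hAB
  refine f.injective ?_
  rw [map_zero, ← hB (f x)]
  simp only [algAssociator, map_sub, hf]

theorem Quaternion.algAssociator_sq_self_self (x : ℍ[ℝ]) : algAssociator (x * x) x x = 0 :=
  sub_eq_zero.2 (mul_assoc _ _ _)

/-- The square `x̄ x` is a real scalar `n`, hence central, and both bracketings equal `n²`. -/
theorem StarQuaternion.algAssociator_sq_self_self (x : StarQuaternion) :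
    algAssociator (x * x) x x = 0 := by
  refine sub_eq_zero.2 ?_
  have key (y : ℍ[ℝ]) : star (star (star y * y) * y) * y = star (star y * y) * (star y * y) := by
    simp only [star_mul, star_star, mul_assoc]
    rw [← mul_assoc (star y) y, Quaternion.star_mul_self, Quaternion.coe_commutes, ← mul_assoc,
      Quaternion.star_mul_self]
  exact key x.toQuaternion

/-- The identity map from `ℍ` to `*ℍ`, as a linear equivalence. -/
noncomputable def StarQuaternion.ofLinearEquiv : ℍ[ℝ] ≃ₗ[ℝ] StarQuaternion :=
  LinearEquiv.refl ℝ ℍ[ℝ]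

theorem algIsomorphic_quaternion_of_mul {a b : ℍ[ℝ]} (ha : a = 1 ∨ a = -1) (hb : b = 1 ∨ b = -1)
    (F : A ≃ₗ[ℝ] ℍ[ℝ]) (hF : ∀ x y, F (x * y) = a * F x * F y * b) : AlgIsomorphic A ℍ[ℝ] := by
  have hpos (hF : ∀ x y, F (x * y) = F x * F y) : AlgIsomorphic A ℍ[ℝ] := ⟨F, hF⟩
  -- The map `-F` removes the sign, since the product is even in the pair of its arguments.
  have hneg (hF : ∀ x y, F (x * y) = -(F x * F y)) : AlgIsomorphic A ℍ[ℝ] :=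
    ⟨F.trans (LinearEquiv.neg ℝ), fun x y => by simp [hF]⟩
  rcases ha with rfl | rfl <;> rcases hb with rfl | rfl
  · exact hpos (by simpa using hF)
  · exact hneg (by simpa using hF)
  · exact hneg (by simpa using hF)
  · exact hpos (by simpa using hF)

theorem algIsomorphic_starQuaternion_of_mul {a b : ℍ[ℝ]} (ha : a = 1 ∨ a = -1)
    (hb : b = 1 ∨ b = -1) (F : A ≃ₗ[ℝ] ℍ[ℝ]) (hF : ∀ x y, F (x * y) = star (F x) * a * F y * b) :
    AlgIsomorphic A StarQuaternion := by
  have hpos (hF : ∀ x y, F (x * y) = star (F x) * F y) : AlgIsomorphic A StarQuaternion :=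
    ⟨F.trans StarQuaternion.ofLinearEquiv, hF⟩
  have hneg (hF : ∀ x y, F (x * y) = -(star (F x) * F y)) : AlgIsomorphic A StarQuaternion := by
    refine ⟨(F.trans (LinearEquiv.neg ℝ)).trans StarQuaternion.ofLinearEquiv, fun x y => ?_⟩
    change -F (x * y) = star (-F x) * -F y
    simp [hF]
  rcases ha with rfl | rfl <;> rcases hb with rfl | rfl
  · exact hpos (by simpa using hF)
  · exact hneg (by simpa using hF)
  · exact hneg (by simpa using hF)
  · exact hpos (by simpa using hF)

end Classification

theorem theorem3p14 (A : Type*) [NormedAddCommGroup A] [NormedSpace ℝ A] [Mul A]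
    [AbsoluteValuedAlgebra A] (hdim : Module.finrank ℝ A = 4) :
    (∀ x : A, algAssociator (x * x) x x = 0) ↔
      (AlgIsomorphic A ℍ[ℝ] ∨ AlgIsomorphic A StarQuaternion) := by
  constructor
  · intro h
    obtain ⟨F, a, b, ha, hb, hF | hF | hF | hF⟩ := AbsoluteValuedAlgebra.exists_normalForm A hdim
    · obtain ⟨ha', hb'⟩ := (squareAssociative_of_linearEquiv h F hF).eq_one_or_neg_one_of_mul ha hb
      exact .inl (algIsomorphic_quaternion_of_mul ha' hb' F hF)
    · obtain ⟨ha', hb'⟩ :=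
        (squareAssociative_of_linearEquiv h F hF).eq_one_or_neg_one_of_star_mul ha hb
      exact .inr (algIsomorphic_starQuaternion_of_mul ha' hb' F hF)
    · exact (not_squareAssociative_mul_star ha hb (squareAssociative_of_linearEquiv h F hF)).elim
    · exact (not_squareAssociative_star_mul_star ha hb
        (squareAssociative_of_linearEquiv h F hF)).elim
  · rintro (h | h)
    · exact h.algAssociator_eq_zero Quaternion.algAssociator_sq_self_self
    · exact h.algAssociator_eq_zero StarQuaternion.algAssociator_sq_self_self
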